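/- Let $\lambda>0$ and $p_1,p_2\in(0,1]$. For each $M\ge 2$ consider $M$ independent items. Item $m$ has $N_m\sim\mathrm{Poisson}(\lambda)$ defects, and, conditionally on $N_m$, the numbers $R_{m,1},R_{m,2}$ of its defects detected by two inspectors are independent with $R_{m,i}\sim\mathrm{Binomial}(N_m,p_i)$; the triples $(N_m,R_{m,1},R_{m,2})$, $1\le m\le M$, are independent. Put $$\bar r_i=\frac1M\sum_{m=1}^M R_{m,i},\qquad \hat S_{1,2}=\frac1{M-1}\sum_{m=1}^M (R_{m,1}-\bar r_1)(R_{m,2}-\bar r_2),$$ and let the moment estimators be $$\hat p_1=\frac{\hat S_{1,2}}{\bar r_2},\qquad \hat p_2=\frac{\hat S_{1,2}}{\bar r_1},\qquad \hat\lambda=\frac{\bar r_1\bar r_2}{\hat S_{1,2}},$$ where each estimator is given an arbitrary fixed real value $d$ (not depending on $M$) on the event that its denominator vanishes. Then the estimators have finite variances for every $M\ge2$, and, for fixed $\lambda,p_1,p_2,d$, as $M\to\infty$, $$\mathrm{Var}(\hat p_i)=\frac{p_i^2}{p_1p_2}\left[1+p_1p_2+\frac{1-p_i}{\lambda}\right]\cdot\frac1M+O\!\left(\frac1{M^2}\right),\qquad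 i=1,2,$$ $$\mathrm{Var}(\hat\lambda)=\lambda\left[\lambda\left(\frac1{p_1p_2}+1\right)+\left(\frac1{p_1}-1\right)\left(\frac1{p_2}-1\right)+1\right]\cdot\frac1M+O\!\left(\frac1{M^2}\right).$$ -/

import Mathlib

open MeasureTheory ProbabilityTheory Filter Asymptotics
open scoped NNReal

noncomputable section

/-- Conditional law of the pair of detection counts of the two inspectors on one item, given that
the item has `n` defects: independent counts, the `i`-th one being `Binomial(n, p i)`. -/
def detectionKernel (p : Fin 2 → unitInterval) : Kernel ℕ (Fin 2 → ℕ) :=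
  Kernel.ofFunOfCountable fun n => Measure.pi fun i => binomial n (p i)

instance (p : Fin 2 → unitInterval) : IsMarkovKernel (detectionKernel p) :=
  ⟨fun n => inferInstanceAs (IsProbabilityMeasure (Measure.pi fun i => binomial n (p i)))⟩

/-- The inspection model for `M` items with defect rate `lam` and detection probabilities `p 0`,
`p 1`: `N m` is the number of defects of item `m`, and `R m i` is the number of those detected by
inspector `i`. -/
structure IsInspectionSample {Ω : Type*} [MeasurableSpace Ω] (P : Measure Ω) {M : ℕ}
    (lam : ℝ≥0) (p : Fin 2 → unitInterval)
    (N : Fin M → Ω → ℕ) (R : Fin M → Fin 2 → Ω → ℕ) : Prop where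
  /-- The number of defects of each item is Poisson with mean `lam`. -/
  defects_law : ∀ m, HasLaw (N m) (poissonMeasure lam) P
  /-- Given `N m`, the counts `R m 0` and `R m 1` are independent and binomial. -/
  detections_law : ∀ m, HasCondDistrib (fun ω i => R m i ω) (N m) (detectionKernel p) P
  /-- Different items are independent. -/
  indep : iIndepFun (fun m ω => (N m ω, fun i => R m i ω)) P

/-- Empirical mean of the counts of inspector `i`. -/
def sampleMean {M : ℕ} (r : Fin M → Fin 2 → ℕ) (i : Fin 2) : ℝ :=
  (∑ m, (r m i : ℝ)) / M

/-- Unbiased empirical covariance of the counts of the two inspectors. -/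
def sampleCov {M : ℕ} (r : Fin M → Fin 2 → ℕ) : ℝ :=
  (∑ m, ((r m 0 : ℝ) - sampleMean r 0) * ((r m 1 : ℝ) - sampleMean r 1)) / ((M : ℝ) - 1)

open Classical in
/-- The quotient `a / b`, with the value `d` where it is undefined, that is, for `b = 0`. -/
def quotientOr (d a b : ℝ) : ℝ := if b = 0 then d else a / b

/-- Moment estimator of `p i`: the empirical covariance divided by the empirical mean of the other
inspector's counts (`1 - i` is the other inspector); value `d` where this is undefined. -/
def pHat (d : ℝ) (i : Fin 2) {M : ℕ} (r : Fin M → Fin 2 → ℕ) : ℝ :=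
  quotientOr d (sampleCov r) (sampleMean r (1 - i))

/-- Moment estimator of the defect rate: the product of the empirical means divided by the empirical
covariance; value `d` where this is undefined. -/
def lamHat (d : ℝ) {M : ℕ} (r : Fin M → Fin 2 → ℕ) : ℝ :=
  quotientOr d (sampleMean r 0 * sampleMean r 1) (sampleCov r)

end

/-! The estimators depend on the counts alone, so one may work with i.i.d. observations from
`itemLaw`. Each estimation error is then a ratio `U = G / (1 + h)`: the numerator `G` is the
empirical mean of a centred function `f` up to a term of size 1/M, and `h`, the relative fluctuation
of the denominator, has size M^(-1/2). Expanding, E U² = E G² - 2 E(G² h) + O(1/M²), E G² = E f² / M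
+ O(1/M²) and E U = O(1/M). Hence Var U = E f² / M + O(1/M²) (`variance_ratio_le`), and what remains
is the second moment of `f`, computed from factorial moments.

Two points need care. Third-order terms such as E(G² h) must be O(1/M²), where norm bounds give only
M^(-3/2). The gain comes from centring: a product of n centred sums has expectation O(M^⌊n/2⌋)
(`abs_integral_prod_sum_le`), so n centred means give M^(-⌈n/2⌉). `MixedOrder` and `HasOrder`
measure size by testing against such products, which preserves this rounding under sums and
products.

Moreover the denominator can be tiny or zero. It is lattice-valued, so when nonzero it is at least
1/M² in absolute value, and `U ^ 2` is at most M^4 times a statistic of order 0. Where |h| > 1/2 one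
has 1 ≤ (2h)^12, whose size M^(-6) turns M^4 into M^(-2). -/

/-! ### Functions with all moments -/

/-- All absolute moments of `f` are finite. -/
def HasAllMoments {α : Type*} [MeasurableSpace α] (f : α → ℝ) (μ : Measure α) : Prop :=
  ∀ q : ℕ, MemLp f q μ

namespace HasAllMoments

variable {α β : Type*} [MeasurableSpace α] [MeasurableSpace β] {μ : Measure α} {f g : α → ℝ}

lemma integrable (hf : HasAllMoments f μ) : Integrable f μ :=
  memLp_one_iff_integrable.1 (by simpa using hf 1)

lemma const [IsFiniteMeasure μ] (c : ℝ) : HasAllMoments (fun _ : α => c) μ :=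
  fun _ => memLp_const c

lemma add (hf : HasAllMoments f μ) (hg : HasAllMoments g μ) :
    HasAllMoments (fun x => f x + g x) μ := fun q => (hf q).add (hg q)

lemma mul (hf : HasAllMoments f μ) (hg : HasAllMoments g μ) :
    HasAllMoments (fun x => f x * g x) μ := fun q => by
  have : ENNReal.HolderTriple ((2 * q : ℕ) : ENNReal) ((2 * q : ℕ) : ENNReal) (q : ENNReal) := ⟨by
    push_cast
    rw [ENNReal.mul_inv (by simp) (by simp), ← add_mul, ENNReal.inv_two_add_inv_two, one_mul]⟩
  exact (hg (2 * q)).mul' (hf (2 * q))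

lemma const_mul [IsFiniteMeasure μ] (c : ℝ) (hf : HasAllMoments f μ) :
    HasAllMoments (fun x => c * f x) μ := (const c).mul hf

lemma sub [IsFiniteMeasure μ] (hf : HasAllMoments f μ) (hg : HasAllMoments g μ) :
    HasAllMoments (fun x => f x - g x) μ := fun q => (hf q).sub (hg q)

lemma sum {ι : Type*} [IsFiniteMeasure μ] (s : Finset ι) {F : ι → α → ℝ}
    (hF : ∀ i ∈ s, HasAllMoments (F i) μ) : HasAllMoments (fun x => ∑ i ∈ s, F i x) μ :=
  fun q => memLp_finsetSum s fun i hi => hF i hi q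

lemma prod {ι : Type*} [IsFiniteMeasure μ] (s : Finset ι) {F : ι → α → ℝ}
    (hF : ∀ i ∈ s, HasAllMoments (F i) μ) : HasAllMoments (fun x => ∏ i ∈ s, F i x) μ := by
  classical
  induction s using Finset.induction_on with
  | empty => simpa using const 1
  | insert a s ha ih =>
    simp only [Finset.prod_insert ha]
    exact (hF a (by simp)).mul (ih fun i hi => hF i (by simp [hi]))

lemma comp {ν : Measure β} {g : β → ℝ} {φ : α → β} (hg : HasAllMoments g ν)
    (hφ : MeasurePreserving φ μ ν) : HasAllMoments (fun x => g (φ x)) μ :=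
  fun q => (hg q).comp_measurePreserving hφ

end HasAllMoments

/-! ### Mixed moments of centred sums -/

section ProductMoments

variable {E : Type*} [MeasurableSpace E] {ν : Measure E} [IsProbabilityMeasure ν]

lemma HasAllMoments.sample_sum {f : E → ℝ} (hf : HasAllMoments f ν) (M : ℕ) :
    HasAllMoments (fun r : Fin M → E => ∑ m, f (r m)) (Measure.pi fun _ => ν) :=
  HasAllMoments.sum _ fun m _ => hf.comp (measurePreserving_eval (fun _ : Fin M => ν) m)

/-- Splitting off one observation from the moments of products of sums. -/
lemma integral_prod_sum_succ {ι : Type*} [DecidableEq ι] (s : Finset ι) {f : ι → E → ℝ}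
    (hf : ∀ i, HasAllMoments (f i) ν) (M : ℕ) :
    ∫ r : Fin (M + 1) → E, ∏ i ∈ s, ∑ m, f i (r m) ∂(Measure.pi fun _ => ν) =
      ∑ t ∈ s.powerset, (∫ r : Fin M → E, ∏ i ∈ t, ∑ m, f i (r m) ∂(Measure.pi fun _ => ν)) *
        ∫ x, ∏ i ∈ s \ t, f i x ∂ν := by
  have hmp := measurePreserving_piFinSuccAbove (fun _ : Fin (M + 1) => ν) 0
  have key := hmp.integral_comp' (fun z : E × (Fin M → E) =>
    ∏ i ∈ s, ((∑ m, f i (z.2 m)) + f i z.1))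
  have e1 : ∫ r : Fin (M + 1) → E, ∏ i ∈ s, ∑ m, f i (r m) ∂(Measure.pi fun _ => ν) =
      ∫ z : E × (Fin M → E), ∏ i ∈ s, ((∑ m, f i (z.2 m)) + f i z.1)
        ∂(ν.prod (Measure.pi fun _ => ν)) := by
    refine Eq.trans (integral_congr_ae (Eventually.of_forall fun r => ?_)) key
    refine Finset.prod_congr rfl fun i _ => ?_
    rw [Fin.sum_univ_succ, add_comm]
    rfl
  rw [e1]
  simp only [Finset.prod_add]
  rw [integral_finsetSum]
  · refine Finset.sum_congr rfl fun t _ => ?_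
    rw [mul_comm, ← integral_prod_mul]
    exact integral_congr_ae (Eventually.of_forall fun z => mul_comm _ _)
  · intro t _
    have := (HasAllMoments.prod (s \ t) fun i _ => hf i).integrable.mul_prod
      (HasAllMoments.prod t fun i _ => (hf i).sample_sum M).integrable
    exact this.congr (Eventually.of_forall fun z => mul_comm _ _)

/-- A mixed moment of order `n` of centred sums of `M` observations is `O(M ^ ⌊n / 2⌋)`. -/
lemma abs_integral_prod_sum_le {ι : Type*} {f : ι → E → ℝ}
    (hf : ∀ i, HasAllMoments (f i) ν) (h0 : ∀ i, ∫ x, f i x ∂ν = 0) (s : Finset ι) :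
    ∃ C : ℝ, 0 ≤ C ∧ ∀ M : ℕ,
      |∫ r : Fin M → E, ∏ i ∈ s, ∑ m, f i (r m) ∂(Measure.pi fun _ => ν)| ≤
        C * (M : ℝ) ^ (s.card / 2) := by
  classical
  induction s using Finset.strongInduction with
  | H s ih =>
    rcases s.eq_empty_or_nonempty with rfl | hs
    · exact ⟨1, zero_le_one, fun M => by simp⟩
    choose! C hC0 hC using ih
    -- When one observation is added, `t = s` reproduces the old moment and a single omitted index
    -- contributes the factor `∫ f i = 0`. Only subsets omitting at least two indices feed the
    -- increment.
    set T := s.powerset.filter fun t => t.card + 2 ≤ s.card with hT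
    set K := ∑ t ∈ T, C t * |∫ x, ∏ i ∈ s \ t, f i x ∂ν| with hK
    have hTs : ∀ t ∈ T, t ⊂ s := by
      intro t ht
      simp only [hT, Finset.mem_filter, Finset.mem_powerset] at ht
      refine Finset.ssubset_iff_subset_ne.2 ⟨ht.1, ?_⟩
      rintro rfl
      omega
    have hK0 : 0 ≤ K := Finset.sum_nonneg fun t ht => mul_nonneg (hC0 t (hTs t ht)) (abs_nonneg _)
    set I : ℕ → ℝ := fun M =>
      ∫ r : Fin M → E, ∏ i ∈ s, ∑ m, f i (r m) ∂(Measure.pi fun _ => ν) with hI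
    have hstep : ∀ M : ℕ, |I (M + 1)| ≤ |I M| + K * ((M : ℝ) + 1) ^ (s.card / 2 - 1) := by
      intro M
      have e : I (M + 1) = I M + ∑ t ∈ T,
          (∫ r : Fin M → E, ∏ i ∈ t, ∑ m, f i (r m) ∂(Measure.pi fun _ => ν)) *
            ∫ x, ∏ i ∈ s \ t, f i x ∂ν := by
        simp only [hI]
        rw [integral_prod_sum_succ s hf M,
          ← Finset.add_sum_erase _ _ (Finset.mem_powerset_self s)]
        congr 1
        · simp
        · symm
          apply Finset.sum_subset
          · intro t ht
            rw [Finset.mem_erase, Finset.mem_powerset]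
            exact ⟨(hTs t ht).ne, (hTs t ht).subset⟩
          · intro t ht htT
            rw [Finset.mem_erase, Finset.mem_powerset] at ht
            have hlt := Finset.card_lt_card (Finset.ssubset_iff_subset_ne.2 ⟨ht.2, ht.1⟩)
            have hc : (s \ t).card = 1 := by
              rw [Finset.card_sdiff_of_subset ht.2]
              simp only [hT, Finset.mem_filter, Finset.mem_powerset, not_and] at htT
              have := htT ht.2
              omega
            obtain ⟨i, hi⟩ := Finset.card_eq_one.1 hc
            rw [hi]
            simp [h0]
      rw [e]
      refine (abs_add_le _ _).trans (add_le_add_right ?_ _)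
      refine (Finset.abs_sum_le_sum_abs _ _).trans ?_
      rw [hK, Finset.sum_mul]
      refine Finset.sum_le_sum fun t ht => ?_
      rw [abs_mul, mul_right_comm]
      refine mul_le_mul_of_nonneg_right ((hC t (hTs t ht) M).trans ?_) (abs_nonneg _)
      refine mul_le_mul_of_nonneg_left ?_ (hC0 t (hTs t ht))
      have htc : t.card / 2 ≤ s.card / 2 - 1 := by
        simp only [hT, Finset.mem_filter] at ht
        omega
      calc (M : ℝ) ^ (t.card / 2) ≤ ((M : ℝ) + 1) ^ (t.card / 2) := by gcongr; linarith
        _ ≤ _ := pow_le_pow_right₀ (by linarith [(M.cast_nonneg : (0 : ℝ) ≤ M)]) htc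
    have hI0 : I 0 = 0 := by
      obtain ⟨i, hi⟩ := hs
      simp only [hI, Finset.univ_eq_empty, Finset.sum_empty]
      simp [Finset.prod_const, Finset.card_ne_zero_of_mem hi]
    -- Sum of M increments, each at most K M^(⌊n/2⌋ - 1).
    have hbound : ∀ M : ℕ, |I M| ≤ K * (M * (M : ℝ) ^ (s.card / 2 - 1)) := by
      intro M
      induction M with
      | zero => simp [hI0]
      | succ M ihM =>
        refine (hstep M).trans ?_
        have h1 : (M : ℝ) ^ (s.card / 2 - 1) ≤ ((M : ℝ) + 1) ^ (s.card / 2 - 1) := by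
          gcongr; linarith
        have h2 := mul_le_mul_of_nonneg_left
          (mul_le_mul_of_nonneg_left h1 (M.cast_nonneg : (0 : ℝ) ≤ M)) hK0
        push_cast
        linarith
    refine ⟨K, hK0, fun M => (hbound M).trans ?_⟩
    rcases Nat.lt_or_ge s.card 2 with h | h
    -- For fewer than two factors the truncated exponent `s.card / 2 - 1` makes the bound a power of
    -- M too weak, but then `T` is empty.
    · have : K = 0 := by
        rw [hK, hT, Finset.filter_false_of_mem (fun t _ => by omega), Finset.sum_empty]
      simp [this]
    · rw [← pow_succ', Nat.sub_add_cancel (by omega)]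

end ProductMoments

/-! ### Calculus of stochastic orders -/

section OrderCalculus

variable {E : Type*} [MeasurableSpace E]

/-- Empirical mean of `f` over the sample `r`. -/
noncomputable def empiricalMean (f : E → ℝ) {M : ℕ} (r : Fin M → E) : ℝ := (∑ m, f (r m)) / M

/-- A function of one observation that is centred and has all moments. -/
structure IsCentred (f : E → ℝ) (ν : Measure E) : Prop where
  moments : HasAllMoments f ν
  integral_eq_zero : ∫ x, f x ∂ν = 0

/-- The statistic `H` behaves, in expectation against products of centred empirical means, like a
product of `j` such means. -/
def MixedOrder (ν : Measure E) (j : ℕ) (H : ∀ M : ℕ, (Fin M → E) → ℝ) : Prop :=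
  (∀ M, 2 ≤ M → HasAllMoments (H M) (Measure.pi fun _ => ν)) ∧
  ∀ (n : ℕ) (f : Fin n → E → ℝ), (∀ i, IsCentred (f i) ν) → ∃ C : ℝ, ∀ M : ℕ, 2 ≤ M →
    |∫ r, H M r * ∏ i, empiricalMean (f i) r ∂(Measure.pi fun _ => ν)| ≤
      C / (M : ℝ) ^ ((j + n + 1) / 2)

/-- The statistic `F` has stochastic order `M ^ (-k / 2)`: multiplication by `F` raises the order of
any statistic by `k`. -/
def HasOrder (ν : Measure E) (k : ℕ) (F : ∀ M : ℕ, (Fin M → E) → ℝ) : Prop :=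
  ∀ j H, MixedOrder ν j H → MixedOrder ν (j + k) fun M r => F M r * H M r

variable {ν : Measure E} {j k l : ℕ} {F G : ∀ M : ℕ, (Fin M → E) → ℝ}

lemma MixedOrder.congr {H H' : ∀ M : ℕ, (Fin M → E) → ℝ} (h : MixedOrder ν j H)
    (e : ∀ M, 2 ≤ M → ∀ r, H M r = H' M r) : MixedOrder ν j H' := by
  have e' : ∀ M, 2 ≤ M → H M = H' M := fun M hM => funext (e M hM)
  refine ⟨fun M hM => e' M hM ▸ h.1 M hM, fun n f hf => ?_⟩
  obtain ⟨C, hC⟩ := h.2 n f hf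
  exact ⟨C, fun M hM => by simpa only [e M hM] using hC M hM⟩

lemma MixedOrder.mono {H : ∀ M : ℕ, (Fin M → E) → ℝ} (h : MixedOrder ν j H) (hk : k ≤ j) :
    MixedOrder ν k H := by
  refine ⟨h.1, fun n f hf => ?_⟩
  obtain ⟨C, hC⟩ := h.2 n f hf
  refine ⟨|C|, fun M hM => (hC M hM).trans ?_⟩
  have hM1 : (1 : ℝ) ≤ M := by exact_mod_cast (by omega : 1 ≤ M)
  have hp : (M : ℝ) ^ ((k + n + 1) / 2) ≤ (M : ℝ) ^ ((j + n + 1) / 2) :=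
    pow_le_pow_right₀ hM1 (by omega)
  exact div_le_div₀ (abs_nonneg _) (le_abs_self _) (by positivity) hp

namespace HasOrder

lemma congr (h : HasOrder ν k F) (e : ∀ M, 2 ≤ M → ∀ r, F M r = G M r) : HasOrder ν k G :=
  fun j H hH => (h j H hH).congr fun M hM r => by rw [e M hM]

lemma mono (h : HasOrder ν k F) (hl : l ≤ k) : HasOrder ν l F :=
  fun j H hH => (h j H hH).mono (by omega)

/-- Orders add because `HasOrder` describes the operator of multiplication by `F`; a product of
statistics is a composition of operators. -/
lemma mul (hF : HasOrder ν k F) (hG : HasOrder ν l G) :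
    HasOrder ν (k + l) fun M r => F M r * G M r := by
  intro j H hH
  have := hF _ _ (hG j H hH)
  simp only [← mul_assoc] at this
  exact this.mono (by omega)

end HasOrder

variable [IsProbabilityMeasure ν]

lemma HasAllMoments.empiricalMean {f : E → ℝ} (hf : HasAllMoments f ν) (M : ℕ) :
    HasAllMoments (fun r : Fin M → E => empiricalMean f r) (Measure.pi fun _ => ν) := by
  simp only [_root_.empiricalMean, div_eq_inv_mul]
  exact (hf.sample_sum M).const_mul _

lemma MixedOrder.one : MixedOrder ν 0 fun _ _ => 1 := by
  refine ⟨fun M _ => HasAllMoments.const 1, fun n f hf => ?_⟩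
  obtain ⟨C, -, hC⟩ := abs_integral_prod_sum_le (fun i => (hf i).moments)
    (fun i => (hf i).integral_eq_zero) Finset.univ
  refine ⟨C, fun M hM => ?_⟩
  have hM0 : (0 : ℝ) < M := by positivity
  simp only [empiricalMean, one_mul, Finset.prod_div_distrib, integral_div, Finset.prod_const,
    Finset.card_univ, Fintype.card_fin, zero_add, abs_div, abs_pow, Nat.abs_cast]
  have h := hC M
  rw [Finset.card_univ, Fintype.card_fin] at h
  rw [div_le_div_iff₀ (by positivity) (by positivity)]
  -- Dividing by M^n turns the exponent ⌊n/2⌋ of the sums into -⌈n/2⌉ for the means.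
  have hn : (n + 1) / 2 + n / 2 = n := by omega
  calc _ ≤ C * (M : ℝ) ^ (n / 2) * (M : ℝ) ^ ((n + 1) / 2) :=
        mul_le_mul_of_nonneg_right h (by positivity)
    _ = C * (M : ℝ) ^ n := by rw [mul_assoc, ← pow_add, add_comm (n / 2), hn]

namespace HasOrder

lemma mixedOrder (h : HasOrder ν k F) : MixedOrder ν k F := by
  have := h 0 _ MixedOrder.one
  simpa using this

lemma hasAllMoments (h : HasOrder ν k F) {M : ℕ} (hM : 2 ≤ M) :
    HasAllMoments (F M) (Measure.pi fun _ => ν) := h.mixedOrder.1 M hM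

lemma integral_le (h : HasOrder ν k F) : ∃ C : ℝ, ∀ M : ℕ, 2 ≤ M →
    |∫ r, F M r ∂(Measure.pi fun _ => ν)| ≤ C / (M : ℝ) ^ ((k + 1) / 2) := by
  simpa using h.mixedOrder.2 0 (fun _ _ => 0) (fun i => i.elim0)

lemma integral_le_of_abs_le (h : HasOrder ν k F) {X : ∀ M : ℕ, (Fin M → E) → ℝ}
    (hX : ∀ M, 2 ≤ M → ∀ r, |X M r| ≤ F M r) : ∃ C : ℝ, ∀ M : ℕ, 2 ≤ M →
    |∫ r, X M r ∂(Measure.pi fun _ => ν)| ≤ C / (M : ℝ) ^ ((k + 1) / 2) := by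
  obtain ⟨C, hC⟩ := h.integral_le
  refine ⟨C, fun M hM => ?_⟩
  rw [← Real.norm_eq_abs]
  exact (norm_integral_le_of_norm_le (h.hasAllMoments hM).integrable
    (Eventually.of_forall (hX M hM))).trans ((le_abs_self _).trans (hC M hM))

lemma add (hF : HasOrder ν k F) (hG : HasOrder ν k G) :
    HasOrder ν k fun M r => F M r + G M r := by
  intro j H hH
  refine ⟨fun M hM => ?_, fun n f hf => ?_⟩
  · simp only [add_mul]
    exact ((hF j H hH).1 M hM).add ((hG j H hH).1 M hM)
  · obtain ⟨C, hC⟩ := (hF j H hH).2 n f hf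
    obtain ⟨D, hD⟩ := (hG j H hH).2 n f hf
    refine ⟨C + D, fun M hM => ?_⟩
    have hp := HasAllMoments.prod Finset.univ fun i _ => (hf i).moments.empiricalMean M
    simp only [add_mul, add_div]
    rw [integral_add (((hF j H hH).1 M hM).mul hp).integrable
      (((hG j H hH).1 M hM).mul hp).integrable]
    exact (abs_add_le _ _).trans (add_le_add (hC M hM) (hD M hM))

/-- The order `2 * e` is even, so it passes through the rounding in the exponent without loss; the
same holds in `natCast_pow_mul`. -/
lemma coeff (e : ℕ) {c : ℕ → ℝ} (hc : ∃ C : ℝ, ∀ M, 2 ≤ M → |c M| ≤ C / (M : ℝ) ^ e) :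
    HasOrder ν (2 * e) fun M _ => c M := by
  intro j H hH
  refine ⟨fun M hM => (hH.1 M hM).const_mul _, fun n f hf => ?_⟩
  obtain ⟨C, hC⟩ := hc
  obtain ⟨D, hD⟩ := hH.2 n f hf
  refine ⟨C * D, fun M hM => ?_⟩
  simp only [mul_assoc, integral_const_mul]
  rw [abs_mul, show (j + 2 * e + n + 1) / 2 = e + (j + n + 1) / 2 by omega, pow_add,
    mul_div_mul_comm]
  exact mul_le_mul (hC M hM) (hD M hM) (abs_nonneg _) ((abs_nonneg _).trans (hC M hM))

lemma natCast_pow_mul (e : ℕ) (h : HasOrder ν (k + 2 * e) F) :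
    HasOrder ν k fun M r => (M : ℝ) ^ e * F M r := by
  intro j H hH
  have hFH := h j H hH
  refine ⟨fun M hM => ?_, fun n f hf => ?_⟩
  · simp only [mul_assoc]
    exact (hFH.1 M hM).const_mul _
  obtain ⟨C, hC⟩ := hFH.2 n f hf
  refine ⟨C, fun M hM => ?_⟩
  have h := hC M hM
  have hM0 : (0 : ℝ) < M := by positivity
  simp only [mul_assoc, integral_const_mul] at h ⊢
  rw [abs_mul, abs_of_nonneg (by positivity : (0 : ℝ) ≤ (M : ℝ) ^ e)]
  rw [show (j + (k + 2 * e) + n + 1) / 2 = e + (j + k + n + 1) / 2 by omega, pow_add] at h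
  calc _ ≤ (M : ℝ) ^ e * (C / ((M : ℝ) ^ e * (M : ℝ) ^ ((j + k + n + 1) / 2))) :=
        mul_le_mul_of_nonneg_left h (by positivity)
    _ = _ := by field_simp

lemma const (c : ℝ) : HasOrder ν 0 fun _ _ => c :=
  coeff 0 (c := fun _ => c) ⟨|c|, fun M _ => by simp⟩

lemma const_mul (c : ℝ) (h : HasOrder ν k F) : HasOrder ν k fun M r => c * F M r := by
  simpa using (const c).mul h

lemma sub (hF : HasOrder ν k F) (hG : HasOrder ν k G) :
    HasOrder ν k fun M r => F M r - G M r := by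
  simpa [sub_eq_add_neg] using hF.add (hG.const_mul (-1))

lemma pow (h : HasOrder ν k F) (n : ℕ) : HasOrder ν (n * k) fun M r => F M r ^ n := by
  induction n with
  | zero => simpa using const 1
  | succ n ih =>
    simp only [pow_succ, Nat.succ_mul]
    exact ih.mul h

lemma mean {f : E → ℝ} (hf : IsCentred f ν) :
    HasOrder ν 1 fun _ r => empiricalMean f r := by
  intro j H hH
  refine ⟨fun M hM => (hf.moments.empiricalMean M).mul (hH.1 M hM), fun n g hg => ?_⟩
  -- The extra mean is absorbed into the family of test functions.
  obtain ⟨C, hC⟩ := hH.2 (n + 1) (Fin.cons f g) (Fin.cases hf hg)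
  refine ⟨C, fun M hM => ?_⟩
  have h := hC M hM
  simp only [Fin.prod_univ_succ, Fin.cons_zero, Fin.cons_succ] at h
  rw [show j + 1 + n + 1 = j + (n + 1) + 1 by ring]
  convert h using 4
  ring

end HasOrder

end OrderCalculus

/-! ### Delta method for a ratio -/

section Ratio

/-- For |h| ≤ 1/2 this is the Taylor remainder of (1 + h)^(-2), where (3 + 2h)/(1 + h)² ≤ 4/(1/4) =
16. Otherwise 1 ≤ (2h)^12 multiplies a crude bound, which also covers 1 + h = 0. -/
lemma abs_sq_ratio_sub_le {U G h V : ℝ} (hU : 1 + h ≠ 0 → U = G / (1 + h)) (hUV : U ^ 2 ≤ V) :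
    |U ^ 2 - (G ^ 2 - 2 * (G ^ 2 * h))| ≤
      16 * (G ^ 2 * h ^ 2) + (2 * h) ^ 12 * (V + G ^ 2 * (2 + h ^ 2)) := by
  have hV : 0 ≤ V := (sq_nonneg U).trans hUV
  rcases le_or_gt |h| (1 / 2) with hh | hh
  · have h1 : 1 / 2 ≤ 1 + h := by linarith [neg_abs_le h]
    have h2 : h ≤ 1 / 2 := (le_abs_self h).trans hh
    have h0 : 1 + h ≠ 0 := by linarith
    have e : U ^ 2 - (G ^ 2 - 2 * (G ^ 2 * h)) = G ^ 2 * h ^ 2 * ((3 + 2 * h) / (1 + h) ^ 2) := by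
      rw [hU h0]; field_simp; ring
    have hq0 : 0 ≤ (3 + 2 * h) / (1 + h) ^ 2 := div_nonneg (by linarith) (sq_nonneg _)
    have hq : (3 + 2 * h) / (1 + h) ^ 2 ≤ 16 := by
      rw [div_le_iff₀ (by positivity)]; nlinarith
    rw [e, abs_of_nonneg (mul_nonneg (by positivity) hq0)]
    have h3 := mul_le_mul_of_nonneg_left hq (by positivity : 0 ≤ G ^ 2 * h ^ 2)
    have h4 : 0 ≤ (2 * h) ^ 12 * (V + G ^ 2 * (2 + h ^ 2)) := by positivity
    linarith
  · have hb : 1 ≤ (2 * h) ^ 12 := by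
      rw [← (by decide : Even 12).pow_abs]
      exact one_le_pow₀ (by rw [abs_mul, abs_two]; linarith)
    have h1 : |U ^ 2 - (G ^ 2 - 2 * (G ^ 2 * h))| ≤ V + G ^ 2 * (2 + h ^ 2) := by
      have hG := sq_nonneg G
      rw [abs_le]
      constructor <;>
      nlinarith [mul_nonneg hG (sq_nonneg (1 + h)), mul_nonneg hG (sq_nonneg (1 - h)), sq_nonneg U]
    have h2 : 0 ≤ V + G ^ 2 * (2 + h ^ 2) := by positivity
    have h3 := mul_le_mul_of_nonneg_right hb h2
    have h4 : 0 ≤ G ^ 2 * h ^ 2 := by positivity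
    linarith

/-- Same dichotomy; for |h| ≤ 1/2, |U - G| = |G h|/(1 + h) ≤ 2|G h| ≤ G² + h². -/
lemma abs_ratio_sub_le {U G h V : ℝ} (hU : 1 + h ≠ 0 → U = G / (1 + h)) (hUV : U ^ 2 ≤ V) :
    |U - G| ≤ G ^ 2 + h ^ 2 + (2 * h) ^ 12 * (2 + V + G ^ 2) := by
  have hV : 0 ≤ V := (sq_nonneg U).trans hUV
  rcases le_or_gt |h| (1 / 2) with hh | hh
  · have h1 : 1 / 2 ≤ 1 + h := by linarith [neg_abs_le h]
    have h0 : 1 + h ≠ 0 := by linarith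
    have e : U - G = -(G * h) / (1 + h) := by
      rw [hU h0]; field_simp; ring
    have h4 : 0 ≤ (2 * h) ^ 12 * (2 + V + G ^ 2) := by positivity
    rw [e, abs_div, abs_neg, abs_mul, abs_of_pos (by linarith : 0 < 1 + h)]
    have h5 : |G| * |h| / (1 + h) ≤ 2 * (|G| * |h|) := by
      rw [div_le_iff₀ (by linarith)]
      nlinarith [mul_nonneg (abs_nonneg G) (abs_nonneg h)]
    nlinarith [sq_nonneg (|G| - |h|), sq_abs G, sq_abs h]
  · have hb : 1 ≤ (2 * h) ^ 12 := by
      rw [← (by decide : Even 12).pow_abs]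
      exact one_le_pow₀ (by rw [abs_mul, abs_two]; linarith)
    have h1 : |U - G| ≤ 2 + V + G ^ 2 := by
      rw [abs_le]
      constructor <;> nlinarith [sq_nonneg (U - 1), sq_nonneg (U + 1), sq_nonneg (G - 1),
        sq_nonneg (G + 1)]
    have h3 := mul_le_mul_of_nonneg_right hb (by positivity : 0 ≤ 2 + V + G ^ 2)
    nlinarith [sq_nonneg G, sq_nonneg h]

variable {E : Type*} [MeasurableSpace E] {ν : Measure E} [IsProbabilityMeasure ν]

lemma IsCentred.integral_empiricalMean {f : E → ℝ} (hf : IsCentred f ν) (M : ℕ) :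
    ∫ r : Fin M → E, empiricalMean f r ∂(Measure.pi fun _ => ν) = 0 := by
  simp only [empiricalMean]
  rw [integral_div, integral_finsetSum]
  · simp [integral_comp_eval (μ := fun _ : Fin M => ν) hf.moments.integrable.aestronglyMeasurable,
      hf.integral_eq_zero]
  · exact fun m _ => (hf.moments.comp (measurePreserving_eval (fun _ : Fin M => ν) m)).integrable

lemma IsCentred.integral_sq_empiricalMean {f : E → ℝ} (hf : IsCentred f ν) {M : ℕ} (hM : M ≠ 0) :
    ∫ r : Fin M → E, empiricalMean f r ^ 2 ∂(Measure.pi fun _ => ν) = (∫ x, f x ^ 2 ∂ν) / M := by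
  have h2 : MemLp f 2 ν := by simpa using hf.moments 2
  have hv : Var[f; ν] = ∫ x, f x ^ 2 ∂ν := by
    rw [variance_eq_sub h2, hf.integral_eq_zero]; simp
  have hs := variance_sum_pi (μ := fun _ : Fin M => ν) (X := fun _ => f) fun _ => h2
  have e : (∑ i : Fin M, fun r : Fin M → E => f (r i)) =
      fun r => M * empiricalMean f r := by
    ext r
    have : (M : ℝ) ≠ 0 := by exact_mod_cast hM
    simp only [empiricalMean, Finset.sum_apply]
    field_simp
  have hm : MemLp (fun r : Fin M → E => empiricalMean f r) 2 (Measure.pi fun _ => ν) := by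
    simpa using hf.moments.empiricalMean M 2
  rw [e, variance_const_mul, variance_eq_sub hm, hf.integral_empiricalMean] at hs
  simp only [Pi.pow_apply, hv, Finset.sum_const, Finset.card_univ, Fintype.card_fin,
    nsmul_eq_mul] at hs
  have : (M : ℝ) ≠ 0 := by exact_mod_cast hM
  field_simp
  apply mul_left_cancel₀ this
  linear_combination hs

/-- Second order delta method for the variance of a ratio `G / (1 + h)` of small statistics. On the
samples where `1 + h = 0`, all that is needed is the growth bound on `U`. -/
theorem variance_ratio_le {U G h W : ∀ M : ℕ, (Fin M → E) → ℝ} {f : E → ℝ}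
    (hf : IsCentred f ν) (hG : HasOrder ν 2 fun M r => G M r - empiricalMean f r)
    (hh : HasOrder ν 1 h) (hW : HasOrder ν 0 W)
    (hUm : ∀ M, 2 ≤ M → AEStronglyMeasurable (U M) (Measure.pi fun _ => ν))
    (hU : ∀ M, 2 ≤ M → ∀ r, 1 + h M r ≠ 0 → U M r = G M r / (1 + h M r))
    (hUW : ∀ M, 2 ≤ M → ∀ r, U M r ^ 2 ≤ (M : ℝ) ^ 4 * W M r) :
    (∀ M, 2 ≤ M → MemLp (U M) 2 (Measure.pi fun _ => ν)) ∧
    ∃ C : ℝ, ∀ M : ℕ, 2 ≤ M →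
      |Var[U M; Measure.pi fun _ => ν] - (∫ x, f x ^ 2 ∂ν) / M| ≤ C / (M : ℝ) ^ 2 := by
  have hm := HasOrder.mean hf
  have hG1 : HasOrder ν 1 G := by
    refine ((hG.mono one_le_two).add hm).congr fun M _ r => by ring
  have hUint : ∀ M, 2 ≤ M → Integrable (fun r => U M r ^ 2) (Measure.pi fun _ => ν) := by
    intro M hM
    refine ((hW.hasAllMoments hM).const_mul ((M : ℝ) ^ 4)).integrable.mono
      ((hUm M hM).pow 2) (Eventually.of_forall fun r => ?_)
    rw [Real.norm_of_nonneg (sq_nonneg _)]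
    exact (hUW M hM r).trans (le_abs_self _)
  have hUL : ∀ M, 2 ≤ M → MemLp (U M) 2 (Measure.pi fun _ => ν) := fun M hM =>
    (memLp_two_iff_integrable_sq (hUm M hM)).2 (hUint M hM)
  refine ⟨hUL, ?_⟩
  have hG2 : HasOrder ν 2 fun M r => G M r ^ 2 := hG1.pow 2
  have hh2 : HasOrder ν 2 fun M r => h M r ^ 2 := hh.pow 2
  have hh12 : HasOrder ν 12 fun M r => (2 * h M r) ^ 12 := (hh.const_mul 2).pow 12
  -- Order 12 from the power of `h`, less 8 for the factor M^4. This remaining order 4 is what fixes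
  -- the exponent 12.
  have hV : HasOrder ν 4 fun M r => (2 * h M r) ^ 12 * ((M : ℝ) ^ 4 * W M r) :=
    (HasOrder.natCast_pow_mul (k := 4) 4 (hh12.mul hW)).congr fun M _ r => by ring
  have hR1 : HasOrder ν 4 fun M r => 16 * (G M r ^ 2 * h M r ^ 2) +
      (2 * h M r) ^ 12 * ((M : ℝ) ^ 4 * W M r + G M r ^ 2 * (2 + h M r ^ 2)) := by
    have h2 : HasOrder ν 0 fun M r => G M r ^ 2 * (2 + h M r ^ 2) :=
      (hG2.mul ((HasOrder.const 2).add (hh2.mono (Nat.zero_le _)))).mono (Nat.zero_le _)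
    refine (((hG2.mul hh2).const_mul 16).add
      (hV.add ((hh12.mul h2).mono (by norm_num)))).congr fun M _ r => by ring
  have hR2 : HasOrder ν 2 fun M r => G M r ^ 2 + h M r ^ 2 +
      (2 * h M r) ^ 12 * (2 + (M : ℝ) ^ 4 * W M r + G M r ^ 2) := by
    have h2 : HasOrder ν 0 fun M r => 2 + G M r ^ 2 :=
      (HasOrder.const 2).add (hG2.mono (Nat.zero_le _))
    refine ((hG2.add hh2).add ((hV.mono (by norm_num)).add
      ((hh12.mul h2).mono (by norm_num)))).congr fun M _ r => by ring
  obtain ⟨C₁, hC₁⟩ := hR1.integral_le_of_abs_le fun M hM r =>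
    abs_sq_ratio_sub_le (hU M hM r) (hUW M hM r)
  obtain ⟨C₂, hC₂⟩ := hR2.integral_le_of_abs_le fun M hM r =>
    abs_ratio_sub_le (hU M hM r) (hUW M hM r)
  obtain ⟨C₃, hC₃⟩ := hG1.integral_le
  have hG2h := hG2.mul hh
  obtain ⟨C₄, hC₄⟩ := hG2h.integral_le
  -- G² minus the squared mean of `f` factors as order 2 times order 1; order 3 then rounds up to
  -- M^(-2).
  have hdiff := hG.mul (hG1.add hm)
  obtain ⟨C₅, hC₅⟩ := hdiff.integral_le
  refine ⟨C₁ + 2 * C₄ + C₅ + (C₂ + C₃) ^ 2, fun M hM => ?_⟩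
  have hM0 : (0 : ℝ) < M := by positivity
  have b1 := hC₁ M hM
  have b2 := hC₂ M hM
  have b3 := hC₃ M hM
  have b4 := hC₄ M hM
  have b5 := hC₅ M hM
  have iG := (hG1.hasAllMoments hM).integrable
  have iG2 := (hG2.hasAllMoments hM).integrable
  have iG2h := (hG2h.hasAllMoments hM).integrable
  have iU := (hUL M hM).integrable one_le_two
  have im2 := ((hm.pow 2).hasAllMoments hM).integrable
  have iGG : Integrable (fun r => G M r ^ 2 - 2 * (G M r ^ 2 * h M r)) (Measure.pi fun _ => ν) :=
    iG2.sub (iG2h.const_mul 2)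
  rw [integral_sub (hUint M hM) iGG,
    integral_sub iG2 (iG2h.const_mul 2), integral_const_mul] at b1
  rw [integral_sub iU iG] at b2
  have e5 : ∫ r, (G M r - empiricalMean f r) * (G M r + empiricalMean f r)
      ∂(Measure.pi fun _ => ν) =
      ∫ r, G M r ^ 2 ∂(Measure.pi fun _ => ν) - (∫ x, f x ^ 2 ∂ν) / M := by
    rw [← hf.integral_sq_empiricalMean (by omega), ← integral_sub iG2 im2]
    exact integral_congr_ae (Eventually.of_forall fun r => by ring)
  rw [e5] at b5
  rw [variance_eq_sub (hUL M hM)]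
  simp only [Pi.pow_apply]
  set u := ∫ r, U M r ∂(Measure.pi fun _ => ν)
  set u2 := ∫ r, U M r ^ 2 ∂(Measure.pi fun _ => ν)
  set g := ∫ r, G M r ∂(Measure.pi fun _ => ν)
  set g2 := ∫ r, G M r ^ 2 ∂(Measure.pi fun _ => ν)
  set gh := ∫ r, G M r ^ 2 * h M r ∂(Measure.pi fun _ => ν)
  -- The exponents (k + 1) / 2 become 2 for orders 4 and 3, and 1 for orders 2 and 1.
  norm_num at b1 b2 b3 b4 b5
  have bu : |u| ≤ (C₂ + C₃) / M := by
    have : u = (u - g) + g := by ring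
    rw [this, add_div]
    exact (abs_add_le _ _).trans (add_le_add b2 b3)
  have bu2 : u ^ 2 ≤ (C₂ + C₃) ^ 2 / (M : ℝ) ^ 2 := by
    rw [← sq_abs, ← div_pow]
    exact pow_le_pow_left₀ (abs_nonneg _) bu 2
  have e : u2 - u ^ 2 - (∫ x, f x ^ 2 ∂ν) / M =
      (u2 - (g2 - 2 * gh)) + (g2 - (∫ x, f x ^ 2 ∂ν) / M) - 2 * gh - u ^ 2 := by ring
  rw [e, add_div, add_div, add_div, mul_div_assoc]
  rw [abs_le] at b1 b4 b5 ⊢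
  have := sq_nonneg u
  constructor <;> linarith [b1.1, b1.2, b4.1, b4.2, b5.1, b5.2]

end Ratio

/-! ### Factorial moments of one item -/

section ItemLaw

lemma integral_binomial_eq_sum_range (n : ℕ) (q : unitInterval) (φ : ℕ → ℝ) :
    ∫ k, φ k ∂(binomial n q) =
      ∑ k ∈ Finset.range (n + 1), φ k * (bernsteinPolynomial ℝ n k).eval (q : ℝ) := by
  have : Finset.range (n + 1) = Finset.Iic n := by ext; simp
  rw [integral_binomial, this]
  refine Finset.sum_congr rfl fun k _ => ?_
  simp [bernsteinPolynomial]
  ring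

lemma integral_id_binomial (n : ℕ) (q : unitInterval) :
    ∫ k, (k : ℝ) ∂(binomial n q) = n * q := by
  rw [integral_binomial_eq_sum_range]
  have h := congrArg (Polynomial.eval (q : ℝ)) (bernsteinPolynomial.sum_smul ℝ n)
  simpa [Polynomial.eval_finsetSum] using h

lemma integral_mul_pred_binomial (n : ℕ) (q : unitInterval) :
    ∫ k, (k : ℝ) * (k - 1) ∂(binomial n q) = n * (n - 1) * (q : ℝ) ^ 2 := by
  have hc : ∀ k : ℕ, ((k * (k - 1) : ℕ) : ℝ) = (k : ℝ) * (k - 1) := by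
    rintro (_ | k) <;> simp
  rw [integral_binomial_eq_sum_range]
  have h := congrArg (Polynomial.eval (q : ℝ)) (bernsteinPolynomial.sum_mul_smul ℝ n)
  simp only [Polynomial.eval_finsetSum, nsmul_eq_mul, Polynomial.eval_mul,
    Polynomial.eval_natCast, hc, Polynomial.eval_pow, Polynomial.eval_X] at h
  exact h

/-- The bound n^q ≤ q! e^n reduces this to the exponential series at e·λ. -/
lemma hasAllMoments_poissonMeasure (lam : ℝ≥0) :
    HasAllMoments (fun n : ℕ => (n : ℝ)) (poissonMeasure lam) := by
  intro q
  rcases Nat.eq_zero_or_pos q with rfl | hq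
  · simpa using AEStronglyMeasurable.of_discrete
  rw [← integrable_norm_rpow_iff .of_discrete (by simpa using hq.ne') (by simp)]
  simp only [ENNReal.toReal_natCast, Real.rpow_natCast, Real.norm_natCast]
  rw [integrable_poissonMeasure_iff]
  have hs := (Real.summable_pow_div_factorial (Real.exp 1 * lam)).mul_left
    (Real.exp (-lam) * q.factorial)
  refine Summable.of_nonneg_of_le (fun n => by positivity) (fun n => ?_) hs
  rw [Real.norm_of_nonneg (by positivity)]
  have h1 : (n : ℝ) ^ q ≤ q.factorial * Real.exp 1 ^ n := by
    have := Real.pow_div_factorial_le_exp (n : ℝ) n.cast_nonneg q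
    rw [div_le_iff₀ (by positivity)] at this
    rw [← Real.exp_nat_mul, mul_one]
    linarith
  calc Real.exp (-lam) * lam ^ n / n.factorial * (n : ℝ) ^ q
      ≤ Real.exp (-lam) * lam ^ n / n.factorial * (q.factorial * Real.exp 1 ^ n) := by gcongr
    _ = _ := by rw [mul_pow]; ring

lemma integral_descFactorial_poissonMeasure (lam : ℝ≥0) (a : ℕ) :
    ∫ n, (n.descFactorial a : ℝ) ∂(poissonMeasure lam) = (lam : ℝ) ^ a := by
  rw [integral_poissonMeasure]
  have h := (hasSum_one_poissonMeasure lam).mul_left ((lam : ℝ) ^ a)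
  rw [mul_one] at h
  -- Terms with n < a vanish; shifting the index by a leaves λ^a times the Poisson weights.
  refine HasSum.tsum_eq ((Function.Injective.hasSum_iff (add_left_injective a) ?_).1 ?_)
  · intro n hn
    have : n < a := by
      by_contra hna
      exact hn ⟨n - a, Nat.sub_add_cancel (not_lt.1 hna)⟩
    simp [Nat.descFactorial_of_lt this]
  · refine (congrArg (HasSum · _) (funext fun n => ?_)).mpr h
    have hf : ((n.factorial : ℝ)) * ((n + a).descFactorial a : ℝ) = (n + a).factorial := by
      have := Nat.factorial_mul_descFactorial (Nat.le_add_left a n)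
      rw [Nat.add_sub_cancel] at this
      exact_mod_cast this
    have h0 : (n.factorial : ℝ) ≠ 0 := by positivity
    have h1 : ((n + a).factorial : ℝ) ≠ 0 := by positivity
    simp only [Function.comp_apply, smul_eq_mul]
    field_simp
    rw [pow_add]
    linear_combination (lam : ℝ) ^ n * (lam : ℝ) ^ a * hf

/-- Law of the pair of detection counts on one item. -/
noncomputable def itemLaw (lam : ℝ≥0) (p : Fin 2 → unitInterval) : Measure (Fin 2 → ℕ) :=
  (poissonMeasure lam ⊗ₘ detectionKernel p).snd

variable (lam : ℝ≥0) (p : Fin 2 → unitInterval)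

instance : IsProbabilityMeasure (itemLaw lam p) := by
  unfold itemLaw; infer_instance

/-- The detections are almost surely bounded by the Poisson number of defects. -/
lemma hasAllMoments_itemLaw (i : Fin 2) :
    HasAllMoments (fun r : Fin 2 → ℕ => (r i : ℝ)) (itemLaw lam p) := by
  have hfst : MeasurePreserving Prod.fst (poissonMeasure lam ⊗ₘ detectionKernel p)
      (poissonMeasure lam) := ⟨measurable_fst, Measure.fst_compProd _ _⟩
  have h := (hasAllMoments_poissonMeasure lam).comp hfst
  have hle : ∀ᵐ z ∂(poissonMeasure lam ⊗ₘ detectionKernel p), z.2 i ≤ z.1 := by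
    refine Measure.ae_compProd_of_ae_ae .of_discrete (Eventually.of_forall fun n => ?_)
    have hb : ∀ᵐ k ∂(binomial n (p i)), k ≤ n :=
      ae_le_of_hasLaw_binomial (X := id) (n := n) (p := p i) ⟨aemeasurable_id, Measure.map_id⟩
    exact (measurePreserving_eval (fun j => binomial n (p j)) i).quasiMeasurePreserving.ae hb
  intro q
  rw [itemLaw, Measure.snd, memLp_map_measure_iff .of_discrete measurable_snd.aemeasurable]
  refine (h q).mono .of_discrete (hle.mono fun z hz => ?_)
  simpa using hz

lemma integral_mul_itemLaw {φ ψ : ℕ → ℝ}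
    (h : Integrable (fun r : Fin 2 → ℕ => φ (r 0) * ψ (r 1)) (itemLaw lam p)) :
    ∫ r, φ (r 0) * ψ (r 1) ∂(itemLaw lam p) =
      ∫ n, (∫ k, φ k ∂(binomial n (p 0))) * ∫ k, ψ k ∂(binomial n (p 1)) ∂(poissonMeasure lam) := by
  rw [itemLaw, Measure.snd, integrable_map_measure .of_discrete measurable_snd.aemeasurable] at h
  rw [itemLaw, Measure.snd, integral_map measurable_snd.aemeasurable .of_discrete,
    Measure.integral_compProd (f := fun z : ℕ × (Fin 2 → ℕ) => φ (z.2 0) * ψ (z.2 1)) h]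
  refine integral_congr_ae (Eventually.of_forall fun n => ?_)
  have := integral_fintype_prod_eq_prod (μ := fun i => binomial n (p i)) (![φ, ψ])
  simp only [Fin.prod_univ_two, Matrix.cons_val_zero, Matrix.cons_val_one] at this
  exact this

lemma cast_descFactorial_succ (n k : ℕ) :
    (n.descFactorial (k + 1) : ℝ) = (n - k) * n.descFactorial k := by
  rcases lt_or_ge n k with h | h
  · simp [Nat.descFactorial_of_lt h]
  · rw [Nat.descFactorial_succ]
    push_cast [h]
    rfl

lemma integral_descFactorial_binomial (n : ℕ) (q : unitInterval) (a : Fin 3) :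
    ∫ k, (k.descFactorial a : ℝ) ∂(binomial n q) = n.descFactorial a * (q : ℝ) ^ (a : ℕ) := by
  fin_cases a
  · simp
  · simpa [cast_descFactorial_succ] using integral_id_binomial n q
  · have := integral_mul_pred_binomial n q
    simp only [cast_descFactorial_succ, Nat.descFactorial_zero]
    simpa [mul_comm, mul_left_comm] using this

/-- Linearises (n)_a (n)_b = Σ_j C(a,j) C(b,j) j! (n)_(a+b-j); each term integrates to a power of λ.
-/
lemma integral_descFactorial_mul_poissonMeasure (a b : Fin 3) :
    ∫ n, (n.descFactorial a : ℝ) * n.descFactorial b ∂(poissonMeasure lam) =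
      ∑ j ∈ Finset.range 3, ((a : ℕ).choose j * (b : ℕ).choose j * j.factorial : ℝ) *
        (lam : ℝ) ^ ((a : ℕ) + b - j) := by
  have hi : ∀ k, Integrable (fun n : ℕ => (n.descFactorial k : ℝ)) (poissonMeasure lam) := by
    intro k
    have : HasAllMoments (fun n : ℕ => (n.descFactorial k : ℝ)) (poissonMeasure lam) := by
      induction k with
      | zero => simpa using HasAllMoments.const 1
      | succ k ih =>
        simp only [cast_descFactorial_succ]
        exact ((hasAllMoments_poissonMeasure lam).sub (HasAllMoments.const _)).mul ih
    exact this.integrable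
  have e : ∀ n : ℕ, (n.descFactorial a : ℝ) * n.descFactorial b =
      ∑ j ∈ Finset.range 3, ((a : ℕ).choose j * (b : ℕ).choose j * j.factorial : ℝ) *
        (n.descFactorial ((a : ℕ) + b - j) : ℝ) := by
    intro n
    fin_cases a <;> fin_cases b <;>
      simp [Finset.sum_range_succ, -Nat.descFactorial_succ, cast_descFactorial_succ] <;>
      ring
  simp only [e]
  rw [integral_finsetSum _ fun j _ => (hi _).const_mul _]
  simp only [integral_const_mul, integral_descFactorial_poissonMeasure]

/-- Expectation under the law of one item of a polynomial of degree at most two in each count,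
written in the basis of falling factorials. -/
lemma integral_itemLaw_descFactorial (c : Fin 3 → Fin 3 → ℝ) :
    ∫ r, ∑ a, ∑ b, c a b * (((r 0).descFactorial a : ℝ) * (r 1).descFactorial b)
        ∂(itemLaw lam p) =
      ∑ a, ∑ b, c a b * ((p 0 : ℝ) ^ (a : ℕ) * (p 1 : ℝ) ^ (b : ℕ) *
        ∑ j ∈ Finset.range 3, ((a : ℕ).choose j * (b : ℕ).choose j * j.factorial : ℝ) *
          (lam : ℝ) ^ ((a : ℕ) + b - j)) := by
  have hd : ∀ i k, HasAllMoments (fun r : Fin 2 → ℕ => ((r i).descFactorial k : ℝ))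
      (itemLaw lam p) := by
    intro i k
    induction k with
    | zero => simpa using HasAllMoments.const 1
    | succ k ih =>
      simp only [cast_descFactorial_succ]
      exact ((hasAllMoments_itemLaw lam p i).sub (HasAllMoments.const _)).mul ih
  have hi : ∀ a b : Fin 3, Integrable (fun r : Fin 2 → ℕ =>
      ((r 0).descFactorial a : ℝ) * (r 1).descFactorial b) (itemLaw lam p) :=
    fun a b => ((hd 0 a).mul (hd 1 b)).integrable
  rw [integral_finsetSum _ fun a _ => integrable_finsetSum _ fun b _ => (hi a b).const_mul _]
  refine Finset.sum_congr rfl fun a _ => ?_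
  rw [integral_finsetSum _ fun b _ => (hi a b).const_mul _]
  refine Finset.sum_congr rfl fun b _ => ?_
  rw [integral_const_mul, integral_mul_itemLaw lam p (φ := fun k => (k.descFactorial a : ℝ))
    (ψ := fun k => (k.descFactorial b : ℝ)) (hi a b)]
  simp only [integral_descFactorial_binomial]
  rw [← integral_descFactorial_mul_poissonMeasure, ← integral_const_mul, ← integral_const_mul,
    ← integral_const_mul]
  refine integral_congr_ae (Eventually.of_forall fun n => ?_)
  ring

lemma integral_itemLaw_bilinear (A B C D : ℝ) :
    ∫ r, (A * ((r 0 : ℝ) * r 1) + B * r 0 + C * r 1 + D) ∂(itemLaw lam p) =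
      A * (p 0 * p 1 * (lam + (lam : ℝ) ^ 2)) + B * (p 0 * lam) + C * (p 1 * lam) + D := by
  have h := integral_itemLaw_descFactorial lam p ![![D, C, 0], ![B, A, 0], ![0, 0, 0]]
  simp [Fin.sum_univ_three, Finset.sum_range_succ, cast_descFactorial_succ, -Nat.descFactorial_succ] at h
  rw [show A * (p 0 * p 1 * (lam + (lam : ℝ) ^ 2)) + B * (p 0 * lam) + C * (p 1 * lam) + D =
    D + C * (p 1 * lam) + (B * (p 0 * lam) + A * (p 0 * p 1 * ((lam : ℝ) ^ 2 + lam))) by ring, ← h]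
  exact integral_congr_ae (Eventually.of_forall fun r => by ring)

lemma integral_itemLaw_bilinear_sq (A B C D : ℝ) :
    ∫ r, (A * ((r 0 : ℝ) * r 1) + B * r 0 + C * r 1 + D) ^ 2 ∂(itemLaw lam p) =
      D ^ 2 + (B ^ 2 + 2 * B * D) * (p 0 * lam) + B ^ 2 * (p 0 * lam) ^ 2 +
      (C ^ 2 + 2 * C * D) * (p 1 * lam) + C ^ 2 * (p 1 * lam) ^ 2 +
      (A ^ 2 + 2 * A * B + 2 * A * C + 2 * A * D + 2 * B * C) *
        (p 0 * p 1 * (lam + (lam : ℝ) ^ 2)) +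
      (A ^ 2 + 2 * A * B) * (p 0 ^ 2 * p 1 * (2 * (lam : ℝ) ^ 2 + (lam : ℝ) ^ 3)) +
      (A ^ 2 + 2 * A * C) * (p 0 * p 1 ^ 2 * (2 * (lam : ℝ) ^ 2 + (lam : ℝ) ^ 3)) +
      A ^ 2 * (p 0 ^ 2 * p 1 ^ 2 * (2 * (lam : ℝ) ^ 2 + 4 * (lam : ℝ) ^ 3 + (lam : ℝ) ^ 4)) := by
  -- Coefficients of the square after substituting k² = (k)_2 + k in each count.
  have h := integral_itemLaw_descFactorial lam p
    ![![D ^ 2, C ^ 2 + 2 * C * D, C ^ 2],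
      ![B ^ 2 + 2 * B * D, A ^ 2 + 2 * A * B + 2 * A * C + 2 * A * D + 2 * B * C,
        A ^ 2 + 2 * A * C],
      ![B ^ 2, A ^ 2 + 2 * A * B, A ^ 2]]
  simp [Fin.sum_univ_three, Finset.sum_range_succ, cast_descFactorial_succ,
    -Nat.descFactorial_succ] at h
  refine Eq.trans ?_ (h.trans ?_)
  · exact integral_congr_ae (Eventually.of_forall fun r => by ring)
  · ring

end ItemLaw

/-! ### Linearisation and lower bounds for the denominators -/

section Estimators

lemma empiricalMean_combination {E : Type*} (f g h : E → ℝ) (a b c : ℝ) {M : ℕ} (r : Fin M → E) :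
    empiricalMean (fun x => a * f x + b * g x + c * h x) r =
      a * empiricalMean f r + b * empiricalMean g r + c * empiricalMean h r := by
  simp only [empiricalMean, Finset.sum_add_distrib, ← Finset.mul_sum]
  ring

/-- Deviation of the count of inspector `i` from its mean. -/
noncomputable def countDev (lam : ℝ≥0) (p : Fin 2 → unitInterval) (i : Fin 2) (r : Fin 2 → ℕ) : ℝ :=
  r i - p i * lam

/-- Deviation of the product of the centred counts from their covariance. -/
noncomputable def covDev (lam : ℝ≥0) (p : Fin 2 → unitInterval) (r : Fin 2 → ℕ) : ℝ :=
  countDev lam p 0 r * countDev lam p 1 r - p 0 * p 1 * lam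

variable (lam : ℝ≥0) (p : Fin 2 → unitInterval)

lemma hasAllMoments_countDev (i : Fin 2) : HasAllMoments (countDev lam p i) (itemLaw lam p) :=
  (hasAllMoments_itemLaw lam p i).sub (HasAllMoments.const _)

lemma isCentred_countDev (i : Fin 2) : IsCentred (countDev lam p i) (itemLaw lam p) := by
  refine ⟨hasAllMoments_countDev lam p i, ?_⟩
  fin_cases i
  · have h := integral_itemLaw_bilinear lam p 0 1 0 (-(p 0 * lam))
    refine Eq.trans (integral_congr_ae (Eventually.of_forall fun r => ?_)) (h.trans (by ring))
    simp [countDev]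
    ring
  · have h := integral_itemLaw_bilinear lam p 0 0 1 (-(p 1 * lam))
    refine Eq.trans (integral_congr_ae (Eventually.of_forall fun r => ?_)) (h.trans (by ring))
    simp [countDev]
    ring

lemma hasAllMoments_covDev : HasAllMoments (covDev lam p) (itemLaw lam p) :=
  ((hasAllMoments_countDev lam p 0).mul (hasAllMoments_countDev lam p 1)).sub
    (HasAllMoments.const _)

lemma isCentred_covDev : IsCentred (covDev lam p) (itemLaw lam p) := by
  refine ⟨hasAllMoments_covDev lam p, ?_⟩
  have h := integral_itemLaw_bilinear lam p 1 (-(p 1 * lam)) (-(p 0 * lam))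
    (p 0 * lam * (p 1 * lam) - p 0 * p 1 * lam)
  refine Eq.trans (integral_congr_ae (Eventually.of_forall fun r => ?_)) (h.trans (by ring))
  simp only [covDev, countDev]
  ring

lemma isCentred_combination (a b c : ℝ) :
    IsCentred (fun r => a * covDev lam p r + b * countDev lam p 0 r + c * countDev lam p 1 r)
      (itemLaw lam p) := by
  have h0 := (isCentred_covDev lam p).moments.const_mul a
  have h1 := (isCentred_countDev lam p 0).moments.const_mul b
  have h2 := (isCentred_countDev lam p 1).moments.const_mul c
  refine ⟨(h0.add h1).add h2, ?_⟩
  rw [integral_add (h0.add h1).integrable h2.integrable, integral_add h0.integrable h1.integrable,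
    integral_const_mul, integral_const_mul, integral_const_mul,
    (isCentred_covDev lam p).integral_eq_zero, (isCentred_countDev lam p 0).integral_eq_zero,
    (isCentred_countDev lam p 1).integral_eq_zero]
  ring

lemma integral_sq_combination (a b c : ℝ) :
    ∫ r, (a * covDev lam p r + b * countDev lam p 0 r + c * countDev lam p 1 r) ^ 2
        ∂(itemLaw lam p) =
      a ^ 2 * (p 0 * p 1 * lam + p 0 * p 1 * (lam : ℝ) ^ 2 + (p 0 * p 1 * lam) ^ 2) +
        b ^ 2 * (p 0 * lam) + c ^ 2 * (p 1 * lam) +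
        2 * (a * b + a * c + b * c) * (p 0 * p 1 * lam) := by
  have h := integral_itemLaw_bilinear_sq lam p a (b - a * (p 1 * lam)) (c - a * (p 0 * lam))
    (a * (p 0 * lam * (p 1 * lam) - p 0 * p 1 * lam) - b * (p 0 * lam) - c * (p 1 * lam))
  refine Eq.trans (integral_congr_ae (Eventually.of_forall fun r => ?_)) (h.trans (by ring))
  simp only [covDev, countDev]
  ring

lemma sampleMean_sub {M : ℕ} (hM : M ≠ 0) (r : Fin M → Fin 2 → ℕ) (i : Fin 2) :
    sampleMean r i - p i * lam = empiricalMean (countDev lam p i) r := by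
  have : (M : ℝ) ≠ 0 := by exact_mod_cast hM
  simp only [sampleMean, empiricalMean, countDev, Finset.sum_sub_distrib, Finset.sum_const,
    Finset.card_univ, Fintype.card_fin, nsmul_eq_mul]
  field_simp

/-- The numerator of the empirical covariance is unchanged by recentring the counts. -/
lemma sum_mul_sub_sampleMean {M : ℕ} (hM : M ≠ 0) (r : Fin M → Fin 2 → ℕ) (u v : ℝ) :
    ∑ m, ((r m 0 : ℝ) - sampleMean r 0) * ((r m 1 : ℝ) - sampleMean r 1) =
      ∑ m, ((r m 0 : ℝ) - u) * ((r m 1 : ℝ) - v) -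
        M * ((sampleMean r 0 - u) * (sampleMean r 1 - v)) := by
  have hM' : (M : ℝ) ≠ 0 := by exact_mod_cast hM
  have h : ∀ i, ∑ m, (r m i : ℝ) = M * sampleMean r i := fun i => by
    simp only [sampleMean]; field_simp
  have e : ∀ s t : ℝ, ∑ m, ((r m 0 : ℝ) - s) * ((r m 1 : ℝ) - t) =
      ∑ m, (r m 0 : ℝ) * r m 1 - t * (M * sampleMean r 0) - s * (M * sampleMean r 1) +
        M * (s * t) := by
    intro s t
    rw [← h, ← h, Finset.mul_sum, Finset.mul_sum, ← Finset.sum_sub_distrib,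
      ← Finset.sum_sub_distrib, show (M : ℝ) * (s * t) = ∑ _m : Fin M, s * t by simp,
      ← Finset.sum_add_distrib]
    exact Finset.sum_congr rfl fun m _ => by ring
  rw [e, e]
  ring

/-- The remainder has order 2: it consists of the product of the two mean deviations and the bias
correction M/(M - 1) = 1 + 1/(M - 1). -/
lemma sampleCov_sub {M : ℕ} (hM : 2 ≤ M) (r : Fin M → Fin 2 → ℕ) :
    sampleCov r - p 0 * p 1 * lam - empiricalMean (covDev lam p) r =
      1 / ((M : ℝ) - 1) * (empiricalMean (covDev lam p) r + p 0 * p 1 * lam -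
        empiricalMean (countDev lam p 0) r * empiricalMean (countDev lam p 1) r) -
      empiricalMean (countDev lam p 0) r * empiricalMean (countDev lam p 1) r := by
  have hM0 : M ≠ 0 := by omega
  have hM' : (M : ℝ) ≠ 0 := by exact_mod_cast hM0
  have hM1 : (M : ℝ) - 1 ≠ 0 := by
    have : (2 : ℝ) ≤ M := by exact_mod_cast hM
    linarith
  have e : ∑ m, ((r m 0 : ℝ) - p 0 * lam) * ((r m 1 : ℝ) - p 1 * lam) =
      M * (empiricalMean (covDev lam p) r + p 0 * p 1 * lam) := by
    simp only [empiricalMean, covDev, countDev, Finset.sum_sub_distrib, Finset.sum_const,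
      Finset.card_univ, Fintype.card_fin, nsmul_eq_mul]
    field_simp
    ring
  rw [sampleCov, sum_mul_sub_sampleMean hM0 r (p 0 * lam) (p 1 * lam), e,
    sampleMean_sub lam p hM0, sampleMean_sub lam p hM0]
  field_simp
  ring

lemma hasOrder_countDev (i : Fin 2) :
    HasOrder (itemLaw lam p) 1 fun _ r => empiricalMean (countDev lam p i) r :=
  HasOrder.mean (isCentred_countDev lam p i)

lemma hasOrder_sampleMean_sub (i : Fin 2) :
    HasOrder (itemLaw lam p) 1 fun _ r => sampleMean r i - p i * lam :=
  (hasOrder_countDev lam p i).congr fun _ hM r => (sampleMean_sub lam p (by omega) r i).symm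

lemma hasOrder_sampleMean (i : Fin 2) :
    HasOrder (itemLaw lam p) 0 fun _ r => sampleMean r i :=
  (((hasOrder_sampleMean_sub lam p i).mono zero_le_one).add (HasOrder.const (p i * lam))).congr
    fun _ _ r => by ring

lemma hasOrder_sampleCov_sub_covDev : HasOrder (itemLaw lam p) 2 fun _ r =>
    sampleCov r - p 0 * p 1 * lam - empiricalMean (covDev lam p) r := by
  have h01 := (hasOrder_countDev lam p 0).mul (hasOrder_countDev lam p 1)
  have hc : HasOrder (itemLaw lam p) (2 * 1) fun M _ => 1 / ((M : ℝ) - 1) := by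
    refine HasOrder.coeff 1 (c := fun M => 1 / ((M : ℝ) - 1)) ⟨2, fun M hM => ?_⟩
    have : (2 : ℝ) ≤ M := by exact_mod_cast hM
    rw [abs_of_pos (div_pos one_pos (by linarith)), pow_one,
      div_le_div_iff₀ (by linarith) (by linarith)]
    linarith
  have h0 := (((HasOrder.mean (isCentred_covDev lam p)).mono zero_le_one).add
    (HasOrder.const (p 0 * p 1 * lam))).sub (h01.mono (Nat.zero_le _))
  exact ((hc.mul h0).sub h01).congr fun M hM r => (sampleCov_sub lam p hM r).symm

lemma hasOrder_sampleCov_sub : HasOrder (itemLaw lam p) 1 fun _ r =>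
    sampleCov r - p 0 * p 1 * lam :=
  (((hasOrder_sampleCov_sub_covDev lam p).mono one_le_two).add
    (HasOrder.mean (isCentred_covDev lam p))).congr fun _ _ r => by ring

lemma hasOrder_sampleCov : HasOrder (itemLaw lam p) 0 fun _ r => sampleCov r :=
  (((hasOrder_sampleCov_sub lam p).mono zero_le_one).add (HasOrder.const (p 0 * p 1 * lam))).congr
    fun _ _ r => by ring

lemma inv_le_sampleMean {M : ℕ} (r : Fin M → Fin 2 → ℕ) (i : Fin 2) (h : sampleMean r i ≠ 0) :
    1 / (M : ℝ) ≤ sampleMean r i := by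
  have hs : ∑ m, r m i ≠ 0 := fun h0 => h (by
    rw [sampleMean, ← Nat.cast_sum, h0, Nat.cast_zero, zero_div])
  have h1 : (1 : ℝ) ≤ ∑ m, (r m i : ℝ) := by
    exact_mod_cast Nat.one_le_iff_ne_zero.2 hs
  rw [sampleMean]
  gcongr

/-- M(M - 1) times the empirical covariance is an integer, so a nonzero value is at least 1/(M(M -
1)) in modulus. -/
lemma inv_sq_le_abs_sampleCov {M : ℕ} (hM : 2 ≤ M) (r : Fin M → Fin 2 → ℕ)
    (h : sampleCov r ≠ 0) : 1 / (M : ℝ) ^ 2 ≤ |sampleCov r| := by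
  have hM0 : M ≠ 0 := by omega
  have hM2 : (2 : ℝ) ≤ M := by exact_mod_cast hM
  have hM' : (M : ℝ) ≠ 0 := by linarith
  have hM1 : (M : ℝ) - 1 ≠ 0 := by linarith
  set z : ℤ := M * ∑ m, (r m 0 : ℤ) * r m 1 - (∑ m, (r m 0 : ℤ)) * ∑ m, (r m 1 : ℤ) with hz
  have e : sampleCov r * (M * ((M : ℝ) - 1)) = z := by
    rw [sampleCov, sum_mul_sub_sampleMean hM0 r 0 0, hz]
    simp only [sampleMean]
    push_cast
    field_simp
    simp only [sub_zero]
    ring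
  have hz0 : z ≠ 0 := by
    rintro h0
    rw [h0, Int.cast_zero] at e
    exact (mul_ne_zero h (mul_ne_zero hM' hM1)) e
  have hz1 : (1 : ℝ) ≤ |(z : ℝ)| := by exact_mod_cast Int.one_le_abs hz0
  rw [← e, abs_mul, abs_of_pos (mul_pos (by linarith) (by linarith) : 0 < (M : ℝ) * (M - 1))] at hz1
  rw [div_le_iff₀ (by positivity)]
  refine hz1.trans (mul_le_mul_of_nonneg_left ?_ (abs_nonneg _))
  nlinarith

lemma quotientOr_sq_le {a b d K : ℝ} (hK : b ≠ 0 → 1 ≤ K * |b|) :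
    quotientOr d a b ^ 2 ≤ d ^ 2 + K ^ 2 * a ^ 2 := by
  rw [quotientOr]
  split_ifs with hb
  · nlinarith [mul_nonneg (sq_nonneg K) (sq_nonneg a)]
  · have h1 : 1 ≤ K ^ 2 * b ^ 2 := by
      have := pow_le_pow_left₀ zero_le_one (hK hb) 2
      rwa [one_pow, mul_pow, sq_abs] at this
    rw [div_pow]
    have : a ^ 2 / b ^ 2 ≤ K ^ 2 * a ^ 2 := by
      rw [div_le_iff₀ (by positivity)]
      nlinarith [sq_nonneg a]
    nlinarith [sq_nonneg d]

/-! ### Variances of the moment estimators -/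

variable {lam p}

theorem variance_pHat_le (hlam : 0 < lam) (hp : ∀ i, 0 < (p i : ℝ)) (d : ℝ) (i : Fin 2) :
    (∀ M, 2 ≤ M → MemLp (fun r : Fin M → Fin 2 → ℕ => pHat d i r) 2
      (Measure.pi fun _ => itemLaw lam p)) ∧
    ∃ C : ℝ, ∀ M : ℕ, 2 ≤ M →
      |Var[fun r : Fin M → Fin 2 → ℕ => pHat d i r; Measure.pi fun _ => itemLaw lam p] -
        (p i : ℝ) ^ 2 / ((p 0 : ℝ) * (p 1 : ℝ)) *
          (1 + (p 0 : ℝ) * (p 1 : ℝ) + (1 - (p i : ℝ)) / (lam : ℝ)) * (1 / (M : ℝ))| ≤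
        C / (M : ℝ) ^ 2 := by
  have hl : (0 : ℝ) < lam := hlam
  have hi := hp i
  have hk := hp (1 - i)
  have hik : (p i : ℝ) * p (1 - i) = p 0 * p 1 := by
    fin_cases i
    · rfl
    · exact mul_comm _ _
  set e : ℝ := p (1 - i) * lam with he
  have he0 : 0 < e := by positivity
  have hc : (p 0 : ℝ) * p 1 * lam = p i * e := by rw [← hik, he, mul_assoc]
  -- The linear part is (covariance deviation - p_i · deviation of the other inspector)/e; the
  -- indicators select the inspector `1 - i`.
  set b₀ : ℝ := -(p i / e) * (if i = 1 then 1 else 0) with hb₀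
  set b₁ : ℝ := -(p i / e) * (if i = 0 then 1 else 0) with hb₁
  set f : (Fin 2 → ℕ) → ℝ := fun r => (1 / e) * covDev lam p r +
    b₀ * countDev lam p 0 r + b₁ * countDev lam p 1 r with hf
  have hG : HasOrder (itemLaw lam p) 2 fun _ r =>
      (sampleCov r - p i * sampleMean r (1 - i)) / e - empiricalMean f r := by
    refine ((hasOrder_sampleCov_sub_covDev lam p).const_mul e⁻¹).congr fun M hM r => ?_
    have hb : b₀ * empiricalMean (countDev lam p 0) r + b₁ * empiricalMean (countDev lam p 1) r =
        -(p i / e) * empiricalMean (countDev lam p (1 - i)) r := by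
      rw [hb₀, hb₁]
      clear_value e
      fin_cases i <;> simp
    rw [hf, empiricalMean_combination, add_assoc, hb, ← sampleMean_sub lam p (by omega), hc, ← he]
    field_simp
    ring
  have hh : HasOrder (itemLaw lam p) 1 fun _ r => (sampleMean r (1 - i) - e) / e :=
    ((hasOrder_sampleMean_sub lam p (1 - i)).const_mul e⁻¹).congr fun M _ r => by rw [he]; ring
  have hW : HasOrder (itemLaw lam p) 0 fun _ r =>
      2 * (d ^ 2 + sampleCov r ^ 2) + 2 * (p i : ℝ) ^ 2 := by
    refine (((HasOrder.const (d ^ 2)).add ((hasOrder_sampleCov lam p).pow 2)).const_mul 2).add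
      (HasOrder.const _)
  have main := variance_ratio_le (U := fun _ r => pHat d i r - p i)
    (isCentred_combination lam p _ _ _) hG hh hW
    (fun M _ => .of_discrete) (fun M _ r hr => ?_) (fun M hM r => ?_)
  · obtain ⟨hL, C, hC⟩ := main
    refine ⟨fun M hM => ?_, C, fun M hM => ?_⟩
    · exact ((hL M hM).add (memLp_const (p i : ℝ))).ae_eq
        (Eventually.of_forall fun r => sub_add_cancel _ _)
    · have h := hC M hM
      rw [variance_sub_const .of_discrete, integral_sq_combination] at h
      convert h using 3
      rw [hb₀, hb₁, he]
      clear_value e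
      have h0 := hp 0
      have h1 := hp 1
      fin_cases i
      · simp
        field_simp
        ring
      · simp
        field_simp
        ring
  · have hS : sampleMean r (1 - i) ≠ 0 := fun h => hr (by rw [h]; field_simp; ring)
    rw [show 1 + (sampleMean r (1 - i) - e) / e = sampleMean r (1 - i) / e by field_simp; ring]
    simp only [pHat, quotientOr, if_neg hS]
    field_simp
  · have hM1 : (1 : ℝ) ≤ M := by exact_mod_cast (by omega : 1 ≤ M)
    have hq := quotientOr_sq_le (a := sampleCov r) (b := sampleMean r (1 - i)) (d := d)
      (K := (M : ℝ)) fun hS => by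
        have := inv_le_sampleMean r (1 - i) hS
        rw [div_le_iff₀ (by positivity)] at this
        linarith [mul_le_mul_of_nonneg_right (le_abs_self (sampleMean r (1 - i)))
          (M.cast_nonneg : (0 : ℝ) ≤ M)]
    have hq' : pHat d i r ^ 2 ≤ d ^ 2 + (M : ℝ) ^ 2 * sampleCov r ^ 2 := hq
    have h2 : (pHat d i r - p i) ^ 2 ≤ 2 * pHat d i r ^ 2 + 2 * (p i : ℝ) ^ 2 := by
      nlinarith [sq_nonneg (pHat d i r + p i)]
    have hM4 : (1 : ℝ) ≤ (M : ℝ) ^ 4 := one_le_pow₀ hM1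
    have h3 := mul_le_mul_of_nonneg_right hM4 (by positivity : 0 ≤ 2 * d ^ 2 + 2 * (p i : ℝ) ^ 2)
    have h4 := mul_le_mul_of_nonneg_right (pow_le_pow_right₀ hM1 (by norm_num : 2 ≤ 4))
      (sq_nonneg (sampleCov r))
    linarith

theorem variance_lamHat_le (hlam : 0 < lam) (hp : ∀ i, 0 < (p i : ℝ)) (d : ℝ) :
    (∀ M, 2 ≤ M → MemLp (fun r : Fin M → Fin 2 → ℕ => lamHat d r) 2
      (Measure.pi fun _ => itemLaw lam p)) ∧
    ∃ C : ℝ, ∀ M : ℕ, 2 ≤ M →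
      |Var[fun r : Fin M → Fin 2 → ℕ => lamHat d r; Measure.pi fun _ => itemLaw lam p] -
        (lam : ℝ) * ((lam : ℝ) * (1 / ((p 0 : ℝ) * (p 1 : ℝ)) + 1) +
          (1 / (p 0 : ℝ) - 1) * (1 / (p 1 : ℝ) - 1) + 1) * (1 / (M : ℝ))| ≤
        C / (M : ℝ) ^ 2 := by
  have hl : (0 : ℝ) < lam := hlam
  have h0 := hp 0
  have h1 := hp 1
  set c : ℝ := p 0 * p 1 * lam with hc
  have hc0 : 0 < c := by positivity
  -- Linear part of (r̄₀ r̄₁ - λ S)/c at the means; the constant terms cancel because p₀λ · p₁λ =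
  -- λc.
  set f : (Fin 2 → ℕ) → ℝ := fun r => (-lam / c) * covDev lam p r +
    (p 1 * lam / c) * countDev lam p 0 r + (p 0 * lam / c) * countDev lam p 1 r with hf
  have hG : HasOrder (itemLaw lam p) 2 fun _ r =>
      (sampleMean r 0 * sampleMean r 1 - lam * sampleCov r) / c - empiricalMean f r := by
    refine ((((hasOrder_countDev lam p 0).mul (hasOrder_countDev lam p 1)).sub
      ((hasOrder_sampleCov_sub_covDev lam p).const_mul lam)).const_mul c⁻¹).congr
      fun M hM r => ?_
    rw [hf, empiricalMean_combination, ← sampleMean_sub lam p (by omega),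
      ← sampleMean_sub lam p (by omega)]
    simp only [hc]
    field_simp
    ring
  have hh : HasOrder (itemLaw lam p) 1 fun _ r => (sampleCov r - c) / c :=
    ((hasOrder_sampleCov_sub lam p).const_mul c⁻¹).congr fun M _ r => by rw [hc]; ring
  have hW : HasOrder (itemLaw lam p) 0 fun _ r =>
      2 * (d ^ 2 + (sampleMean r 0 * sampleMean r 1) ^ 2) + 2 * (lam : ℝ) ^ 2 := by
    refine (((HasOrder.const (d ^ 2)).add (((hasOrder_sampleMean lam p 0).mul
      (hasOrder_sampleMean lam p 1)).pow 2)).const_mul 2).add (HasOrder.const _)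
  have main := variance_ratio_le (U := fun _ r => lamHat d r - lam)
    (isCentred_combination lam p _ _ _) hG hh hW
    (fun M _ => .of_discrete) (fun M _ r hr => ?_) (fun M hM r => ?_)
  · obtain ⟨hL, C, hC⟩ := main
    refine ⟨fun M hM => ?_, C, fun M hM => ?_⟩
    · exact ((hL M hM).add (memLp_const (lam : ℝ))).ae_eq
        (Eventually.of_forall fun r => sub_add_cancel _ _)
    · have h := hC M hM
      rw [variance_sub_const .of_discrete, integral_sq_combination] at h
      convert h using 3
      simp only [hc]
      field_simp
      ring
  · have hS : sampleCov r ≠ 0 := fun h => hr (by rw [h]; field_simp; ring)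
    rw [show 1 + (sampleCov r - c) / c = sampleCov r / c by field_simp; ring]
    simp only [lamHat, quotientOr, if_neg hS]
    field_simp
  · have hM1 : (1 : ℝ) ≤ M := by exact_mod_cast (by omega : 1 ≤ M)
    have hq := quotientOr_sq_le (a := sampleMean r 0 * sampleMean r 1) (b := sampleCov r) (d := d)
      (K := (M : ℝ) ^ 2) fun hS => by
        have := inv_sq_le_abs_sampleCov hM r hS
        rw [div_le_iff₀ (by positivity)] at this
        linarith
    have h2 : (lamHat d r - lam) ^ 2 ≤ 2 * lamHat d r ^ 2 + 2 * (lam : ℝ) ^ 2 := by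
      nlinarith [sq_nonneg (lamHat d r + lam)]
    have hM4 : (1 : ℝ) ≤ (M : ℝ) ^ 4 := one_le_pow₀ hM1
    rw [← pow_mul] at hq
    have h3 := mul_le_mul_of_nonneg_right hM4 (by positivity : 0 ≤ 2 * d ^ 2 + 2 * (lam : ℝ) ^ 2)
    have hq' : lamHat d r ^ 2 ≤ _ := hq
    norm_num at hq'
    linarith

end Estimators

/-! ### Passage from the model to the product law -/

section Transfer

variable {Ω : Type*} [MeasurableSpace Ω] {P : Measure Ω} {M : ℕ}
  {lam : ℝ≥0} {p : Fin 2 → unitInterval} {N : Fin M → Ω → ℕ} {R : Fin M → Fin 2 → Ω → ℕ}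

lemma IsInspectionSample.aemeasurable_counts (h : IsInspectionSample P lam p N R) :
    AEMeasurable (fun ω m i => R m i ω) P :=
  aemeasurable_pi_lambda _ fun m => (h.detections_law m).aemeasurable_snd

variable [IsProbabilityMeasure P]

/-- Independence of items survives forgetting the defect numbers, and each item's counts have the
second marginal of the joint law. -/
lemma IsInspectionSample.map_counts (h : IsInspectionSample P lam p N R) :
    P.map (fun ω m i => R m i ω) = Measure.pi fun _ => itemLaw lam p := by
  have hm : ∀ m, AEMeasurable (fun ω i => R m i ω) P :=
    fun m => (h.detections_law m).aemeasurable_snd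
  have hind : iIndepFun (fun m ω i => R m i ω) P :=
    h.indep.comp (fun _ => Prod.snd) fun _ => measurable_snd
  rw [(iIndepFun_iff_map_fun_eq_pi_map hm).1 hind]
  congr 1
  funext m
  have hl := (h.defects_law m).prodMk_of_hasCondDistrib (h.detections_law m)
  rw [itemLaw, ← hl.map_eq, Measure.snd,
    AEMeasurable.map_map_of_aemeasurable measurable_snd.aemeasurable hl.aemeasurable]
  rfl

lemma IsInspectionSample.memLp_iff (h : IsInspectionSample P lam p N R)
    (g : (Fin M → Fin 2 → ℕ) → ℝ) :
    MemLp (fun ω => g fun m i => R m i ω) 2 P ↔ MemLp g 2 (Measure.pi fun _ => itemLaw lam p) := by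
  rw [← h.map_counts, memLp_map_measure_iff .of_discrete h.aemeasurable_counts]
  rfl

lemma IsInspectionSample.variance_eq (h : IsInspectionSample P lam p N R)
    (g : (Fin M → Fin 2 → ℕ) → ℝ) :
    Var[fun ω => g fun m i => R m i ω; P] = Var[g; Measure.pi fun _ => itemLaw lam p] := by
  rw [← h.map_counts, variance_map .of_discrete h.aemeasurable_counts]
  rfl

end Transfer

lemma isBigO_one_div_sq_of_le {F : ℕ → ℝ} {C : ℝ}
    (h : ∀ M : ℕ, 2 ≤ M → |F M| ≤ C / (M : ℝ) ^ 2) :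
    F =O[atTop] fun M : ℕ => 1 / (M : ℝ) ^ 2 := by
  refine IsBigO.of_bound C ((eventually_ge_atTop 2).mono fun M hM => ?_)
  rw [Real.norm_eq_abs, Real.norm_of_nonneg (by positivity), mul_one_div]
  exact h M hM

theorem theorem2
    (lam : ℝ≥0) (hlam : 0 < lam)
    (p : Fin 2 → unitInterval) (hp : ∀ i, 0 < (p i : ℝ))
    {Ω : ℕ → Type*} [∀ M, MeasurableSpace (Ω M)]
    (P : ∀ M, Measure (Ω M)) [∀ M, IsProbabilityMeasure (P M)]
    (N : ∀ M, Fin M → Ω M → ℕ) (R : ∀ M, Fin M → Fin 2 → Ω M → ℕ)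
    (hR : ∀ M, 2 ≤ M → IsInspectionSample (P M) lam p (N M) (R M))
    -- the value given to an estimator on the data for which it is undefined
    (d : ℝ) :
    (∀ i : Fin 2,
      (∀ M, 2 ≤ M → MemLp (fun ω => pHat d i (fun m j => R M m j ω)) 2 (P M)) ∧
      (fun M : ℕ =>
          Var[fun ω => pHat d i (fun m j => R M m j ω); P M]
            - (p i : ℝ) ^ 2 / ((p 0 : ℝ) * (p 1 : ℝ))
                * (1 + (p 0 : ℝ) * (p 1 : ℝ) + (1 - (p i : ℝ)) / (lam : ℝ)) * (1 / (M : ℝ)))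
        =O[atTop] fun M : ℕ => 1 / (M : ℝ) ^ 2) ∧
    (∀ M, 2 ≤ M → MemLp (fun ω => lamHat d (fun m j => R M m j ω)) 2 (P M)) ∧
    (fun M : ℕ =>
        Var[fun ω => lamHat d (fun m j => R M m j ω); P M]
          - (lam : ℝ) * ((lam : ℝ) * (1 / ((p 0 : ℝ) * (p 1 : ℝ)) + 1)
              + (1 / (p 0 : ℝ) - 1) * (1 / (p 1 : ℝ) - 1) + 1) * (1 / (M : ℝ)))
      =O[atTop] fun M : ℕ => 1 / (M : ℝ) ^ 2 := by
  refine ⟨fun i => ?_, ?_⟩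
  · obtain ⟨hL, C, hC⟩ := variance_pHat_le hlam hp d i
    refine ⟨fun M hM => ((hR M hM).memLp_iff _).2 (hL M hM),
      isBigO_one_div_sq_of_le (C := C) fun M hM => ?_⟩
    rw [(hR M hM).variance_eq fun r => pHat d i r]
    exact hC M hM
  · obtain ⟨hL, C, hC⟩ := variance_lamHat_le hlam hp d
    refine ⟨fun M hM => ((hR M hM).memLp_iff _).2 (hL M hM),
      isBigO_one_div_sq_of_le (C := C) fun M hM => ?_⟩
    rw [(hR M hM).variance_eq fun r => lamHat d r]
    exact hC M hM
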